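/- Let $d\ge 1$, and let $\mathbb{T}^d=(\mathbb{R}/\mathbb{Z})^d$ carry its normalized Lebesgue measure. For $r>1$ let $L^{r,\infty}(\mathbb{T}^d)$ be the space of measurable functions $m:\mathbb{T}^d\to\mathbb{C}$ for which there is a constant $c>0$ with $$\big|\{\xi\in\mathbb{T}^d:\ |m(\xi)|\ge s\}\big|\le \frac{c}{s^{r}}\qquad\text{for all } s>0 .$$ For $f\in\ell^2(\mathbb{Z}^d)$ let $\mathcal{F}f(\xi)=\sum_{n\in\mathbb{Z}^d}f(n)e^{2\pi i n\cdot\xi}\in L^2(\mathbb{T}^d)$ (convergence in $L^2$), and let $T_m$ be the Fourier multiplier operator $$T_mf(n)=\mathcal{F}^{-1}(m\,\mathcal{F}f)(n)=\int_{\mathbb{T}^d}m(\xi)\,\mathcal{F}f(\xi)\,e^{-2\pi i n\cdot\xi}\,d\xi,\qquad n\in\mathbb{Z}^d .$$ Let $m\in L^{\alpha,\infty}(\mathbb{T}^d)$ with $1<\alpha<\infty$, and let $$1<p\le 2\le q<\infty,\qquad \frac1p-\frac1q\ge\frac1\alpha .$$ Then $T_m$ is a bounded linear operator from $\ell^p(\mathbb{Z}^d)$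 into $\ell^q(\mathbb{Z}^d)$: for every $f\in\ell^p(\mathbb{Z}^d)\subset\ell^2(\mathbb{Z}^d)$ the function $m\,\mathcal{F}f$ is integrable on $\mathbb{T}^d$, $T_mf\in\ell^q(\mathbb{Z}^d)$, and there is a constant $C$, independent of $f$, such that $\|T_mf\|_{\ell^q}\le C\|f\|_{\ell^p}$. -/

import Mathlib

open MeasureTheory
open scoped ENNReal

noncomputable section

namespace DiscreteMultiplier

/-- The space `ℓ^p(ℤ^d)` of complex-valued functions on `ℤ^d`. -/
abbrev ellp (d : ℕ) (p : ℝ≥0∞) : Type := lp (fun _ : Fin d → ℤ => ℂ) p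

/-- The normalized Lebesgue (Haar) measure `dξ` on the torus `𝕋^d = (ℝ/ℤ)^d`. -/
abbrev torusMeasure (d : ℕ) : Measure (UnitAddTorus (Fin d)) :=
  Measure.pi fun _ => AddCircle.haarAddCircle

/-- `m ∈ L^{r,∞}(𝕋^d)`: `m` is measurable and, for some `c > 0`,
`|{ξ : |m(ξ)| ≥ s}| ≤ c / s^r` for all `s > 0`. -/
def MemWeakLp {d : ℕ} (m : UnitAddTorus (Fin d) → ℂ) (r : ℝ) : Prop :=
  AEMeasurable m (torusMeasure d) ∧
    ∃ c : ℝ, 0 < c ∧ ∀ s : ℝ, 0 < s →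
      torusMeasure d {ξ | s ≤ ‖m ξ‖} ≤ ENNReal.ofReal (c / s ^ r)

/-- The Fourier transform `f ↦ ∑ n, f(n) e^{2πi n·ξ}`, as an isometry of `ℓ²(ℤ^d)` onto
`L²(𝕋^d)` (the series converges in `L²`). -/
def fourierZ {d : ℕ} (f : ellp d 2) : Lp ℂ 2 (torusMeasure d) :=
  UnitAddTorus.mFourierBasis.repr.symm f

/-- The function `m · 𝓕 f` on the torus. -/
def multiplierSymbol {d : ℕ} (m : UnitAddTorus (Fin d) → ℂ) (f : ellp d 2) :
    UnitAddTorus (Fin d) → ℂ :=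
  fun ξ => m ξ * fourierZ f ξ

/-- The Fourier multiplier operator
`T_m f (n) = 𝓕⁻¹(m · 𝓕 f)(n) = ∫ m(ξ) 𝓕 f(ξ) e^{-2πi n·ξ} dξ`. -/
def multiplierOp {d : ℕ} (m : UnitAddTorus (Fin d) → ℂ) (f : ellp d 2) :
    (Fin d → ℤ) → ℂ :=
  fun n => UnitAddTorus.mFourierCoeff (multiplierSymbol m f) n

/-- `T_m` is a bounded linear operator from `ℓ^p(ℤ^d)` into `ℓ^q(ℤ^d)`. It is required that every
`f ∈ ℓ^p` lies in `ℓ²` (so that `𝓕 f` makes sense) and that `m · 𝓕 f` is integrable, so that the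
integral defining `T_m f` is a genuine one. -/
def IsBoundedMultiplier {d : ℕ} (m : UnitAddTorus (Fin d) → ℂ) (p q : ℝ≥0∞) : Prop :=
  ∃ T : ellp d p →ₗ[ℂ] ellp d q,
    (∃ C : ℝ, ∀ f : ellp d p, ‖T f‖ ≤ C * ‖f‖) ∧
    ∀ f : ellp d p, ∃ hf : Memℓp (f : (Fin d → ℤ) → ℂ) 2,
      Integrable (multiplierSymbol m ⟨f, hf⟩) (torusMeasure d) ∧
      ∀ n : Fin d → ℤ, T f n = multiplierOp m ⟨f, hf⟩ n

end DiscreteMultiplier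

end

namespace DiscreteMultiplier

/-! ### Fourier series on `ℓ²`: finite truncations and Plancherel -/

variable {d : ℕ}

/-! The core is a Paley inequality: for `1 < p < 2` and a weight `w` in weak `L^{p/(2-p)}`, the
integral of `w |𝓕f|²` is bounded on the unit ball of `ℓ^p`
(`lintegral_weight_mul_enorm_fourierZ_sq_le`). By the layer-cake formula it suffices to bound
`|𝓕f|²` on each `{w ≥ t}`. There `f` is cut at size `t^{-1/(2-p)}`: Plancherel handles the small
coefficients, and the sup norm times the measure of the set handles the large ones. Integrating over
`t` returns a multiple of `|f(n)|^p` term by term.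

Since `L^{α,∞}` spaces on a probability space are nested, one may assume `1/p - 1/q = 1/α`. With `r`
conjugate to `q`, `|m|` is the geometric mean of `|m|^{α(2/p-1)}` and `|m|^{α(2/r-1)}`, both
admissible weights (at `p = 2` or `r = 2` the weight is 1). Cauchy–Schwarz bounds the integral of
`|m 𝓕f 𝓕h|` for `f` in `ℓ^p` and `h` in `ℓ^r`, and duality gives the `ℓ^q` bound. -/

theorem fourierZ_add (f g : ellp d 2) : fourierZ (f + g) = fourierZ f + fourierZ g :=
  map_add _ f g

theorem fourierZ_smul (c : ℂ) (f : ellp d 2) : fourierZ (c • f) = c • fourierZ f :=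
  map_smul UnitAddTorus.mFourierBasis.repr.symm c f

theorem fourierZ_single (n : Fin d → ℤ) (c : ℂ) :
    fourierZ (lp.single 2 n c) =ᵐ[torusMeasure d] fun ξ => c * UnitAddTorus.mFourier n ξ := by
  have h : (lp.single 2 n c : ellp d 2) = c • lp.single 2 n 1 := by
    rw [← lp.single_smul]; simp
  have h1 : fourierZ (lp.single 2 n 1) = UnitAddTorus.mFourierLp 2 n := by
    have := UnitAddTorus.mFourierBasis.repr_symm_single n
    rw [UnitAddTorus.coe_mFourierBasis] at this
    exact this
  rw [h, fourierZ_smul, h1]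
  filter_upwards [Lp.coeFn_smul c (UnitAddTorus.mFourierLp 2 n),
    UnitAddTorus.coeFn_mFourierLp 2 n] with ξ h2 h3
  rw [h2, Pi.smul_apply, h3, smul_eq_mul]

/-- The finitely supported truncation of `f` to the set `S`. -/
noncomputable def restrictTo (S : Finset (Fin d → ℤ)) (f : (Fin d → ℤ) → ℂ) : ellp d 2 :=
  ∑ n ∈ S, lp.single 2 n (f n)

theorem restrictTo_apply (S : Finset (Fin d → ℤ)) (f : (Fin d → ℤ) → ℂ) (n : Fin d → ℤ) :
    restrictTo S f n = if n ∈ S then f n else 0 := by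
  rw [restrictTo, lp.coeFn_sum, Finset.sum_apply]
  simp [lp.single_apply, Pi.single_apply]

theorem fourierZ_restrictTo (S : Finset (Fin d → ℤ)) (f : (Fin d → ℤ) → ℂ) :
    fourierZ (restrictTo S f) =ᵐ[torusMeasure d]
      fun ξ => ∑ n ∈ S, f n * UnitAddTorus.mFourier n ξ := by
  classical
  unfold restrictTo
  induction S using Finset.induction_on with
  | empty =>
    have : fourierZ (0 : ellp d 2) = 0 := map_zero UnitAddTorus.mFourierBasis.repr.symm
    simp only [Finset.sum_empty, this]
    exact Lp.coeFn_zero _ _ _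
  | insert a S ha ih =>
    rw [Finset.sum_insert ha, fourierZ_add]
    filter_upwards [ih, fourierZ_single a (f a),
      Lp.coeFn_add (fourierZ (lp.single 2 a (f a)))
        (fourierZ (∑ n ∈ S, lp.single 2 n (f n)))] with ξ h1 h2 h3
    rw [h3, Pi.add_apply, h1, h2, Finset.sum_insert ha]

theorem norm_mFourier_apply (n : Fin d → ℤ) (ξ : UnitAddTorus (Fin d)) :
    ‖UnitAddTorus.mFourier n ξ‖ = 1 := by
  simp only [UnitAddTorus.mFourier, fourier_apply, ContinuousMap.coe_mk, norm_prod,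
    Circle.norm_coe, Finset.prod_const_one]

theorem enorm_mFourier_apply (n : Fin d → ℤ) (ξ : UnitAddTorus (Fin d)) :
    ‖UnitAddTorus.mFourier n ξ‖ₑ = 1 := by
  rw [← ofReal_norm, norm_mFourier_apply, ENNReal.ofReal_one]

theorem lintegral_enorm_fourierZ_sq (f : ellp d 2) :
    ∫⁻ ξ, ‖fourierZ f ξ‖ₑ ^ 2 ∂torusMeasure d = ∑' n, ‖f n‖ₑ ^ 2 := by
  have h1 : ‖fourierZ f‖ = ‖f‖ := LinearIsometryEquiv.norm_map _ f
  have h2 : ‖f‖ ^ 2 = ∑' n, ‖f n‖ ^ 2 := by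
    simpa using lp.norm_rpow_eq_tsum (p := 2) (by simp) f
  have h3 : Summable fun n => ‖f n‖ ^ 2 := by
    simpa using (lp.memℓp f).summable (p := 2) (by simp)
  have h4 : ∑' n, ‖f n‖ₑ ^ 2 = ENNReal.ofReal (‖f‖ ^ 2) := by
    rw [h2, ENNReal.ofReal_tsum_of_nonneg (fun n => by positivity) h3]
    simp [ENNReal.ofReal_pow]
  rw [h4, ← h1, Lp.norm_def, ENNReal.ofReal_pow (by positivity),
    ENNReal.ofReal_toReal (Lp.eLpNorm_ne_top _),
    eLpNorm_eq_lintegral_rpow_enorm_toReal (by simp) (by simp), ← ENNReal.rpow_natCast,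
    ← ENNReal.rpow_mul]
  simp

theorem measurable_enorm_fourierZ_sq (f : ellp d 2) :
    Measurable fun ξ => ‖fourierZ f ξ‖ₑ ^ 2 :=
  (Lp.stronglyMeasurable _).measurable.enorm.pow_const 2

/-! ### Weighted Paley inequality -/

theorem ennreal_add_sq_le (a b : ℝ≥0∞) : (a + b) ^ 2 ≤ 2 * a ^ 2 + 2 * b ^ 2 := by
  have := ENNReal.rpow_add_le_mul_rpow_add_rpow a b (p := 2) (by norm_num)
  norm_num at this
  rwa [mul_add] at this

/-- Splitting `f` into its restriction to a finite set and the rest: the rest is controlled by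
Plancherel's theorem, the restriction by the trivial sup norm bound. -/
theorem setLIntegral_enorm_fourierZ_sq_le (f : ellp d 2) (S : Finset (Fin d → ℤ))
    (E : Set (UnitAddTorus (Fin d))) :
    ∫⁻ ξ in E, ‖fourierZ f ξ‖ₑ ^ 2 ∂torusMeasure d ≤
      2 * (∑' n, if n ∈ S then 0 else ‖f n‖ₑ ^ 2) +
        2 * (torusMeasure d E * (∑ n ∈ S, ‖f n‖ₑ) ^ 2) := by
  set g := restrictTo S f
  set h := f - g
  have hfgh : f = h + g := by simp [h]
  have hh : ∀ n, ‖h n‖ₑ ^ 2 = if n ∈ S then 0 else ‖f n‖ₑ ^ 2 := by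
    intro n
    simp only [h, g, lp.coeFn_sub, Pi.sub_apply, restrictTo_apply]
    split_ifs <;> simp
  have hae : ∀ᵐ ξ ∂torusMeasure d,
      ‖fourierZ f ξ‖ₑ ^ 2 ≤ 2 * ‖fourierZ h ξ‖ₑ ^ 2 + 2 * (∑ n ∈ S, ‖f n‖ₑ) ^ 2 := by
    have h1 : fourierZ f = fourierZ h + fourierZ g := by rw [← fourierZ_add, ← hfgh]
    rw [h1]
    filter_upwards [Lp.coeFn_add (fourierZ h) (fourierZ g), fourierZ_restrictTo S f] with ξ h2 h3
    rw [h2, Pi.add_apply]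
    refine le_trans (pow_le_pow_left' (enorm_add_le _ _) 2) ?_
    refine (ennreal_add_sq_le _ _).trans ?_
    gcongr
    rw [h3]
    refine (enorm_sum_le _ _).trans (Finset.sum_le_sum fun n _ => ?_)
    rw [enorm_mul, enorm_mFourier_apply, mul_one]
  calc ∫⁻ ξ in E, ‖fourierZ f ξ‖ₑ ^ 2 ∂torusMeasure d
      ≤ ∫⁻ ξ in E, (2 * ‖fourierZ h ξ‖ₑ ^ 2 + 2 * (∑ n ∈ S, ‖f n‖ₑ) ^ 2) ∂torusMeasure d :=
        lintegral_mono_ae (ae_restrict_of_ae hae)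
    _ = 2 * ∫⁻ ξ in E, ‖fourierZ h ξ‖ₑ ^ 2 ∂torusMeasure d +
        2 * (torusMeasure d E * (∑ n ∈ S, ‖f n‖ₑ) ^ 2) := by
        rw [lintegral_add_right _ measurable_const,
          lintegral_const_mul _ (measurable_enorm_fourierZ_sq h), lintegral_const,
          Measure.restrict_apply_univ]
        ring
    _ ≤ _ := by
        gcongr
        refine (setLIntegral_le_lintegral _ _).trans_eq ?_
        rw [lintegral_enorm_fourierZ_sq]
        simp_rw [hh]

/-- The contribution at height `t` of a coefficient of size `a` to the weighted Paley estimate. -/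
noncomputable def levelTerm (p c a t : ℝ) : ℝ :=
  if 1 < t * a ^ (2 - p) then c * t ^ (-(1 / (2 - p))) * a else a ^ 2

theorem measurable_levelTerm (p c a : ℝ) : Measurable (levelTerm p c a) := by
  unfold levelTerm
  refine Measurable.ite ?_ (by fun_prop) (by fun_prop)
  exact measurableSet_lt measurable_const (by fun_prop)

/-- The two regimes meet at `τ = a^{-(2-p)}`. Below it the integral is `τ a² = a^p`; above it the
power tail converges because `1/(2-p) > 1`, which is `p > 1`, and again scales like `a^p`. -/
theorem lintegral_levelTerm_le {p c a : ℝ} (hp : 1 < p) (hp2 : p < 2) (hc : 0 ≤ c) (ha : 0 ≤ a) :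
    ∫⁻ t in Set.Ioi (0 : ℝ), ENNReal.ofReal (levelTerm p c a t) ≤
      ENNReal.ofReal ((1 + c * ((2 - p) / (p - 1))) * a ^ p) := by
  have h2p : 0 < 2 - p := by linarith
  have hp1 : 0 < p - 1 := by linarith
  rcases ha.eq_or_lt with rfl | ha
  · simp [levelTerm, Real.zero_rpow h2p.ne']
  set τ := a ^ (-(2 - p)) with hτ
  have hτ0 : 0 < τ := Real.rpow_pos_of_pos ha _
  have hiff : ∀ t : ℝ, 1 < t * a ^ (2 - p) ↔ τ < t := by
    intro t
    rw [hτ, Real.rpow_neg ha.le, inv_lt_iff_one_lt_mul₀ (Real.rpow_pos_of_pos ha _), mul_comm]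
  have hexp : -(1 / (2 - p)) < -1 := by
    rw [neg_lt_neg_iff, lt_div_iff₀ h2p]; linarith
  have hset : Set.Ioi (0 : ℝ) = Set.Ioc 0 τ ∪ Set.Ioi τ := (Set.Ioc_union_Ioi_eq_Ioi hτ0.le).symm
  have hlow : ∫⁻ t in Set.Ioc 0 τ, ENNReal.ofReal (levelTerm p c a t) = ENNReal.ofReal (a ^ p) := by
    rw [setLIntegral_congr_fun (g := fun _ => ENNReal.ofReal (a ^ 2)) measurableSet_Ioc]
    · rw [setLIntegral_const, Real.volume_Ioc, ← ENNReal.ofReal_mul (by positivity), sub_zero, hτ,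
        ← Real.rpow_natCast, ← Real.rpow_add ha]
      congr 2; push_cast; ring
    · intro t ht
      simp only [levelTerm, hiff, not_lt.mpr ht.2, if_false]
  have hhigh : ∫⁻ t in Set.Ioi τ, ENNReal.ofReal (levelTerm p c a t) =
      ENNReal.ofReal (c * ((2 - p) / (p - 1)) * a ^ p) := by
    rw [setLIntegral_congr_fun
      (g := fun t => ENNReal.ofReal (c * a * t ^ (-(1 / (2 - p))))) measurableSet_Ioi]
    · rw [← ofReal_integral_eq_lintegral_ofReal
        ((integrableOn_Ioi_rpow_of_lt hexp hτ0).const_mul (c * a)), integral_const_mul,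
        integral_Ioi_rpow_of_lt hexp hτ0]
      · congr 1
        rw [hτ, ← Real.rpow_mul ha.le]
        have e1 : -(2 - p) * (-(1 / (2 - p)) + 1) = p - 1 := by field_simp; ring
        have e2 : -(1 / (2 - p)) + 1 = -((p - 1) / (2 - p)) := by field_simp; ring
        have e3 : a ^ p = a * a ^ (p - 1) := by
          rw [← Real.rpow_one_add' ha.le (by linarith)]; congr 1; ring
        rw [e1, e2, e3, neg_div_neg_eq]
        field_simp
      · filter_upwards [ae_restrict_mem measurableSet_Ioi] with t ht
        have : 0 < t := hτ0.trans ht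
        simp only [Pi.zero_apply]; positivity
    · intro t ht
      have : τ < t := ht
      simp only [levelTerm, hiff, this, if_true]
      congr 1; ring
  rw [hset, lintegral_union measurableSet_Ioi Set.Ioc_disjoint_Ioi_same, hlow, hhigh,
    ← ENNReal.ofReal_add (by positivity) (by positivity)]
  apply le_of_eq; congr 1; ring

theorem setLIntegral_enorm_fourierZ_sq_le_levelTerm {p c t : ℝ} (hp : 1 < p) (hp2 : p < 2)
    (hc : 0 ≤ c) (ht : 0 < t) (f : ellp d 2) (hf : ∑' n, ENNReal.ofReal (‖f n‖ ^ p) ≤ 1)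
    {E : Set (UnitAddTorus (Fin d))}
    (hE : torusMeasure d E ≤ ENNReal.ofReal (c / t ^ (p / (2 - p)))) :
    ∫⁻ ξ in E, ‖fourierZ f ξ‖ₑ ^ 2 ∂torusMeasure d ≤
      2 * ∑' n, ENNReal.ofReal (levelTerm p c ‖f n‖ t) := by
  classical
  have h2p : 0 < 2 - p := by linarith
  have hp1 : 0 < p - 1 := by linarith
  have hlarge : ∀ a : ℝ, 0 ≤ a → 1 < t * a ^ (2 - p) → a ≤ t ^ ((p - 1) / (2 - p)) * a ^ p := by
    intro a ha h
    have ha0 : 0 < a := by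
      refine ha.lt_of_ne fun h0 => ?_
      rw [← h0, Real.zero_rpow h2p.ne'] at h; linarith
    have h1 : 1 ≤ (t * a ^ (2 - p)) ^ ((p - 1) / (2 - p)) :=
      Real.one_le_rpow h.le (by positivity)
    rw [Real.mul_rpow ht.le (by positivity), ← Real.rpow_mul ha,
      mul_div_cancel₀ _ h2p.ne'] at h1
    calc a ≤ a * (t ^ ((p - 1) / (2 - p)) * a ^ (p - 1)) := le_mul_of_one_le_right ha h1
      _ = t ^ ((p - 1) / (2 - p)) * a ^ p := by
        have : a ^ p = a * a ^ (p - 1) := by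
          rw [← Real.rpow_one_add' ha (by linarith)]; congr 1; ring
        rw [this]; ring
  -- Chebyshev: `|f(n)|^p` is at least `t^{-p/(2-p)}` on this set, and it is summable.
  have hfin : {n | 1 < t * ‖f n‖ ^ (2 - p)}.Finite := by
    have hne : ENNReal.ofReal ((1 / t) ^ (p / (2 - p))) ≠ 0 := by
      simp only [ne_eq, ENNReal.ofReal_eq_zero, not_le]; positivity
    refine (ENNReal.finite_const_le_of_tsum_ne_top (ne_top_of_le_ne_top ENNReal.one_ne_top hf)
      hne).subset fun n hn => ENNReal.ofReal_le_ofReal ?_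
    have h1 : 1 / t ≤ ‖f n‖ ^ (2 - p) := by
      rw [div_le_iff₀ ht, mul_comm]; exact le_of_lt hn
    have h2 := Real.rpow_le_rpow (by positivity) h1 (show 0 ≤ p / (2 - p) by positivity)
    rwa [← Real.rpow_mul (norm_nonneg _), mul_div_cancel₀ _ h2p.ne'] at h2
  set S := hfin.toFinset with hS
  have hmem : ∀ n, n ∈ S ↔ 1 < t * ‖f n‖ ^ (2 - p) := fun n => by simp [hS]
  have hsum : ∑ n ∈ S, ‖f n‖ₑ ≤ ENNReal.ofReal (t ^ ((p - 1) / (2 - p))) := by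
    calc ∑ n ∈ S, ‖f n‖ₑ
        ≤ ∑ n ∈ S, ENNReal.ofReal (t ^ ((p - 1) / (2 - p))) * ENNReal.ofReal (‖f n‖ ^ p) := by
          refine Finset.sum_le_sum fun n hn => ?_
          rw [← ENNReal.ofReal_mul (by positivity), ← ofReal_norm]
          exact ENNReal.ofReal_le_ofReal (hlarge _ (norm_nonneg _) ((hmem n).1 hn))
      _ ≤ ENNReal.ofReal (t ^ ((p - 1) / (2 - p))) * 1 := by
          rw [← Finset.mul_sum]
          gcongr
          exact (ENNReal.sum_le_tsum S).trans hf
      _ = _ := mul_one _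
  have hcoef : c / t ^ (p / (2 - p)) * t ^ ((p - 1) / (2 - p)) = c * t ^ (-(1 / (2 - p))) := by
    rw [div_eq_mul_inv, ← Real.rpow_neg ht.le, mul_assoc, ← Real.rpow_add ht]
    congr 2; field_simp; ring
  -- Only one of the two factors is replaced by the bound `hsum`. The other stays a sum, so the
  -- estimate is linear in `|f(n)|` and can be integrated in `t` term by term.
  have hterm : torusMeasure d E * (∑ n ∈ S, ‖f n‖ₑ) ^ 2 ≤
      ∑' n, if n ∈ S then ENNReal.ofReal (c * t ^ (-(1 / (2 - p))) * ‖f n‖) else 0 := by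
    rw [tsum_eq_sum (s := S) (fun n hn => by simp [hn])]
    calc torusMeasure d E * (∑ n ∈ S, ‖f n‖ₑ) ^ 2
        ≤ ENNReal.ofReal (c / t ^ (p / (2 - p))) *
          (ENNReal.ofReal (t ^ ((p - 1) / (2 - p))) * ∑ n ∈ S, ‖f n‖ₑ) := by
          rw [sq]; gcongr
      _ = ENNReal.ofReal (c * t ^ (-(1 / (2 - p)))) * ∑ n ∈ S, ‖f n‖ₑ := by
          rw [← mul_assoc, ← ENNReal.ofReal_mul (by positivity), hcoef]
      _ = _ := by
          rw [Finset.mul_sum]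
          refine Finset.sum_congr rfl fun n hn => ?_
          rw [if_pos hn, ENNReal.ofReal_mul (p := c * _) (by positivity), ofReal_norm]
  refine (setLIntegral_enorm_fourierZ_sq_le f S E).trans ?_
  rw [← mul_add]
  gcongr
  refine (add_le_add_right hterm _).trans_eq ?_
  rw [← ENNReal.tsum_add]
  refine tsum_congr fun n => ?_
  by_cases hn : n ∈ S
  · simp [hn, levelTerm, (hmem n).1 hn]
  · simp [hn, levelTerm, mt (hmem n).2 hn, ENNReal.ofReal_pow]

/-- Weighted Paley inequality for the Fourier series of an `ℓ^p` sequence, `1 < p < 2`, with a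
weight in weak `L^{p/(2-p)}`. -/
theorem lintegral_weight_mul_enorm_fourierZ_sq_le {p c : ℝ} (hp : 1 < p) (hp2 : p < 2)
    (hc : 0 ≤ c) {w : UnitAddTorus (Fin d) → ℝ} (hw : AEMeasurable w (torusMeasure d))
    (hw0 : ∀ ξ, 0 ≤ w ξ)
    (hweak : ∀ t : ℝ, 0 < t →
      torusMeasure d {ξ | t ≤ w ξ} ≤ ENNReal.ofReal (c / t ^ (p / (2 - p))))
    (f : ellp d 2) (hf : ∑' n, ENNReal.ofReal (‖f n‖ ^ p) ≤ 1) :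
    ∫⁻ ξ, ENNReal.ofReal (w ξ) * ‖fourierZ f ξ‖ₑ ^ 2 ∂torusMeasure d ≤
      ENNReal.ofReal (2 * (1 + c * ((2 - p) / (p - 1)))) := by
  have hp1 : 0 < p - 1 := by linarith
  have h2p : 0 < 2 - p := by linarith
  -- The layer-cake formula is applied to `w` under the measure `|𝓕f|² dξ`.
  set ν := (torusMeasure d).withDensity fun ξ => ‖fourierZ f ξ‖ₑ ^ 2 with hν
  have hac : ν ≪ torusMeasure d := withDensity_absolutelyContinuous _ _
  have hwν : AEMeasurable w ν := hw.mono_ac hac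
  calc ∫⁻ ξ, ENNReal.ofReal (w ξ) * ‖fourierZ f ξ‖ₑ ^ 2 ∂torusMeasure d
      = ∫⁻ ξ, ENNReal.ofReal (w ξ) ∂ν := by
        rw [hν, lintegral_withDensity_eq_lintegral_mul₀
          (measurable_enorm_fourierZ_sq f).aemeasurable hw.ennreal_ofReal]
        simp only [Pi.mul_apply, mul_comm]
    _ = ∫⁻ t in Set.Ioi 0, ν {ξ | t ≤ w ξ} :=
        lintegral_eq_lintegral_meas_le ν (Filter.Eventually.of_forall hw0) hwν
    _ ≤ ∫⁻ t in Set.Ioi 0, 2 * ∑' n, ENNReal.ofReal (levelTerm p c ‖f n‖ t) := by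
        refine setLIntegral_mono' measurableSet_Ioi fun t ht => ?_
        rw [hν, withDensity_apply']
        exact setLIntegral_enorm_fourierZ_sq_le_levelTerm hp hp2 hc ht f hf (hweak t ht)
    _ = 2 * ∑' n, ∫⁻ t in Set.Ioi 0, ENNReal.ofReal (levelTerm p c ‖f n‖ t) := by
        have hmeas : ∀ n, Measurable fun t => ENNReal.ofReal (levelTerm p c ‖f n‖ t) :=
          fun n => (measurable_levelTerm p c _).ennreal_ofReal
        rw [lintegral_const_mul _ (Measurable.tsum hmeas),
          lintegral_tsum fun n => (hmeas n).aemeasurable]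
    _ ≤ 2 * ∑' n, ENNReal.ofReal ((1 + c * ((2 - p) / (p - 1))) * ‖f n‖ ^ p) := by
        gcongr with n
        exact lintegral_levelTerm_le hp hp2 hc (norm_nonneg _)
    _ = 2 * (ENNReal.ofReal (1 + c * ((2 - p) / (p - 1))) *
          ∑' n, ENNReal.ofReal (‖f n‖ ^ p)) := by
        simp_rw [← ENNReal.tsum_mul_left, ENNReal.ofReal_mul (show 0 ≤ 1 + c * ((2 - p) / (p - 1)) by positivity)]
    _ ≤ 2 * (ENNReal.ofReal (1 + c * ((2 - p) / (p - 1))) * 1) := by gcongr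
    _ = _ := by
        rw [mul_one, ENNReal.ofReal_mul (by norm_num), ENNReal.ofReal_ofNat]

/-! ### Powers of `|m|` as weights and the bilinear estimate -/

theorem MemWeakLp.mono_exponent {m : UnitAddTorus (Fin d) → ℂ} {r s : ℝ} (hm : MemWeakLp m r)
    (hs : 0 ≤ s) (hsr : s ≤ r) : MemWeakLp m s := by
  obtain ⟨hmeas, c, hc, h⟩ := hm
  refine ⟨hmeas, max c 1, by positivity, fun t ht => ?_⟩
  have hts := Real.rpow_pos_of_pos ht s
  rcases le_total 1 t with h1 | h1
  · refine (h t ht).trans (ENNReal.ofReal_le_ofReal ?_)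
    exact div_le_div₀ (by positivity) (le_max_left _ _) hts
      (Real.rpow_le_rpow_of_exponent_le h1 hsr)
  · refine prob_le_one.trans ?_
    rw [ENNReal.one_le_ofReal, le_div_iff₀ hts, one_mul]
    exact (Real.rpow_le_one ht.le h1 hs).trans (le_max_right _ _)

/-- The weight lies in weak `L^{p/(2-p)}` because `α(2/p-1) · p/(2-p) = α`. -/
theorem exists_lintegral_rpow_mul_enorm_fourierZ_sq_le {m : UnitAddTorus (Fin d) → ℂ} {α p : ℝ}
    (hα : 0 < α) (hm : MemWeakLp m α) (hp : 1 < p) (hp2 : p ≤ 2) :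
    ∃ K : ℝ, 0 ≤ K ∧ ∀ f : ellp d 2, ∑' n, ENNReal.ofReal (‖f n‖ ^ p) ≤ 1 →
      ∫⁻ ξ, ENNReal.ofReal (‖m ξ‖ ^ (α * (2 / p - 1))) * ‖fourierZ f ξ‖ₑ ^ 2 ∂torusMeasure d ≤
        ENNReal.ofReal K := by
  obtain ⟨hmeas, c, hc, h⟩ := hm
  rcases hp2.eq_or_lt with rfl | hp2
  -- At `p = 2` the exponent vanishes and only Plancherel remains.
  · refine ⟨1, zero_le_one, fun f hf => ?_⟩
    norm_num
    rw [lintegral_enorm_fourierZ_sq]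
    simpa [ENNReal.ofReal_pow] using hf
  have hp1 : 0 < p - 1 := by linarith
  have h2p : 0 < 2 - p := by linarith
  have he : 0 < 2 / p - 1 := by
    rw [sub_pos, one_lt_div (by linarith)]; exact hp2
  refine ⟨2 * (1 + c * ((2 - p) / (p - 1))), by positivity, fun f hf => ?_⟩
  refine lintegral_weight_mul_enorm_fourierZ_sq_le hp hp2 hc.le (hmeas.norm.pow_const _)
    (fun ξ => by positivity) (fun t ht => ?_) f hf
  set s := t ^ (α * (2 / p - 1))⁻¹
  have hs : 0 < s := Real.rpow_pos_of_pos ht _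
  have hset : {ξ | t ≤ ‖m ξ‖ ^ (α * (2 / p - 1))} = {ξ | s ≤ ‖m ξ‖} := by
    ext ξ
    exact (Real.rpow_inv_le_iff_of_pos ht.le (norm_nonneg _) (by positivity)).symm
  rw [hset]
  refine (h s hs).trans_eq ?_
  congr 2
  rw [← Real.rpow_mul ht.le]
  congr 1
  have : p ≠ 0 := by linarith
  have e : 2 / p - 1 = (2 - p) / p := by field_simp
  rw [e]
  field_simp

theorem exists_lintegral_enorm_mul_fourierZ_mul_fourierZ_le {m : UnitAddTorus (Fin d) → ℂ}
    {α p r : ℝ} (hα : 0 < α) (hm : MemWeakLp m α) (hp : 1 < p) (hp2 : p ≤ 2) (hr : 1 < r)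
    (hr2 : r ≤ 2) (hpr : α * (2 / p - 1) + α * (2 / r - 1) = 2) :
    ∃ K : ℝ, 0 ≤ K ∧ ∀ f h : ellp d 2, ∑' n, ENNReal.ofReal (‖f n‖ ^ p) ≤ 1 →
      ∑' n, ENNReal.ofReal (‖h n‖ ^ r) ≤ 1 →
      ∫⁻ ξ, ‖m ξ‖ₑ * ‖fourierZ f ξ‖ₑ * ‖fourierZ h ξ‖ₑ ∂torusMeasure d ≤ ENNReal.ofReal K := by
  obtain ⟨K₁, hK₁, h₁⟩ := exists_lintegral_rpow_mul_enorm_fourierZ_sq_le hα hm hp hp2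
  obtain ⟨K₂, hK₂, h₂⟩ := exists_lintegral_rpow_mul_enorm_fourierZ_sq_le hα hm hr hr2
  have nonneg : ∀ x : ℝ, 1 < x → x ≤ 2 → 0 ≤ α * (2 / x - 1) := fun x hx hx2 =>
    mul_nonneg hα.le (by rw [sub_nonneg, one_le_div (by linarith)]; exact hx2)
  have hx₁ := nonneg p hp hp2
  have hx₂ := nonneg r hr hr2
  set x₁ := α * (2 / p - 1)
  set x₂ := α * (2 / r - 1)
  refine ⟨K₁ ^ (1 / 2 : ℝ) * K₂ ^ (1 / 2 : ℝ), by positivity, fun f h hf hh => ?_⟩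
  let A (x : ℝ) (g : ellp d 2) (ξ : UnitAddTorus (Fin d)) : ℝ≥0∞ :=
    ENNReal.ofReal (‖m ξ‖ ^ (x / 2)) * ‖fourierZ g ξ‖ₑ
  have hA : ∀ x g, AEMeasurable (A x g) (torusMeasure d) := fun x g =>
    (hm.1.norm.pow_const _).ennreal_ofReal.mul
      (Lp.stronglyMeasurable _).measurable.enorm.aemeasurable
  have hA2 : ∀ x g ξ, A x g ξ ^ (2 : ℝ) = ENNReal.ofReal (‖m ξ‖ ^ x) * ‖fourierZ g ξ‖ₑ ^ 2 := by
    intro x g ξ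
    rw [ENNReal.rpow_ofNat, mul_pow, ← ENNReal.ofReal_pow (by positivity), ← Real.rpow_natCast,
      ← Real.rpow_mul (norm_nonneg _)]
    congr 3; push_cast; ring
  calc ∫⁻ ξ, ‖m ξ‖ₑ * ‖fourierZ f ξ‖ₑ * ‖fourierZ h ξ‖ₑ ∂torusMeasure d
      = ∫⁻ ξ, (A x₁ f * A x₂ h) ξ ∂torusMeasure d := by
        refine lintegral_congr fun ξ => ?_
        have : ‖m ξ‖ₑ = ENNReal.ofReal (‖m ξ‖ ^ (x₁ / 2)) * ENNReal.ofReal (‖m ξ‖ ^ (x₂ / 2)) := by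
          rw [← ENNReal.ofReal_mul (by positivity),
            ← Real.rpow_add_of_nonneg (norm_nonneg _) (by positivity) (by positivity), ← add_div,
            hpr, div_self two_ne_zero, Real.rpow_one, ofReal_norm]
        rw [this, Pi.mul_apply]
        ring
    _ ≤ (∫⁻ ξ, A x₁ f ξ ^ (2 : ℝ) ∂torusMeasure d) ^ (1 / 2 : ℝ) *
        (∫⁻ ξ, A x₂ h ξ ^ (2 : ℝ) ∂torusMeasure d) ^ (1 / 2 : ℝ) :=
        ENNReal.lintegral_mul_le_Lp_mul_Lq _ Real.HolderConjugate.two_two (hA _ _) (hA _ _)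
    _ ≤ ENNReal.ofReal K₁ ^ (1 / 2 : ℝ) * ENNReal.ofReal K₂ ^ (1 / 2 : ℝ) := by
        simp_rw [hA2]
        gcongr
        · exact h₁ f hf
        · exact h₂ h hh
    _ = _ := by
        rw [ENNReal.ofReal_rpow_of_nonneg hK₁ (by norm_num),
          ENNReal.ofReal_rpow_of_nonneg hK₂ (by norm_num), ENNReal.ofReal_mul (by positivity)]

/-! ### Linearity of `T_m` and its pairing with finite sequences -/

theorem aestronglyMeasurable_multiplierSymbol {m : UnitAddTorus (Fin d) → ℂ}
    (hm : AEMeasurable m (torusMeasure d)) (f : ellp d 2) :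
    AEStronglyMeasurable (multiplierSymbol m f) (torusMeasure d) :=
  hm.aestronglyMeasurable.mul (Lp.aestronglyMeasurable _)

theorem multiplierSymbol_add (m : UnitAddTorus (Fin d) → ℂ) (f g : ellp d 2) :
    multiplierSymbol m (f + g) =ᵐ[torusMeasure d] multiplierSymbol m f + multiplierSymbol m g := by
  filter_upwards [Lp.coeFn_add (fourierZ f) (fourierZ g)] with ξ h
  simp only [multiplierSymbol, fourierZ_add, h, Pi.add_apply, mul_add]

theorem multiplierSymbol_smul (m : UnitAddTorus (Fin d) → ℂ) (c : ℂ) (f : ellp d 2) :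
    multiplierSymbol m (c • f) =ᵐ[torusMeasure d] c • multiplierSymbol m f := by
  filter_upwards [Lp.coeFn_smul c (fourierZ f)] with ξ h
  simp only [multiplierSymbol, fourierZ_smul, h, Pi.smul_apply, smul_eq_mul]
  ring

theorem multiplierOp_eq_integral (m : UnitAddTorus (Fin d) → ℂ) (f : ellp d 2) (n : Fin d → ℤ) :
    multiplierOp m f n =
      ∫ ξ, UnitAddTorus.mFourier (-n) ξ * multiplierSymbol m f ξ ∂torusMeasure d := rfl

theorem integrable_mFourier_mul {F : UnitAddTorus (Fin d) → ℂ} (hF : Integrable F (torusMeasure d))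
    (n : Fin d → ℤ) : Integrable (fun ξ => UnitAddTorus.mFourier n ξ * F ξ) (torusMeasure d) :=
  hF.bdd_mul (c := 1) (UnitAddTorus.mFourier n).continuous.aestronglyMeasurable
    (Filter.Eventually.of_forall fun ξ => (norm_mFourier_apply n ξ).le)

theorem multiplierOp_add {m : UnitAddTorus (Fin d) → ℂ} {f g : ellp d 2}
    (hf : Integrable (multiplierSymbol m f) (torusMeasure d))
    (hg : Integrable (multiplierSymbol m g) (torusMeasure d)) :
    multiplierOp m (f + g) = multiplierOp m f + multiplierOp m g := by
  funext n
  rw [Pi.add_apply]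
  simp only [multiplierOp_eq_integral]
  rw [← integral_add (integrable_mFourier_mul hf _) (integrable_mFourier_mul hg _)]
  refine integral_congr_ae ?_
  filter_upwards [multiplierSymbol_add m f g] with ξ h
  rw [h, Pi.add_apply, mul_add]

theorem multiplierOp_smul (m : UnitAddTorus (Fin d) → ℂ) (c : ℂ) (f : ellp d 2) :
    multiplierOp m (c • f) = c • multiplierOp m f := by
  funext n
  rw [Pi.smul_apply, smul_eq_mul]
  simp only [multiplierOp_eq_integral]
  rw [← integral_const_mul]
  refine integral_congr_ae ?_
  filter_upwards [multiplierSymbol_smul m c f] with ξ h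
  rw [h, Pi.smul_apply, smul_eq_mul]
  ring

/-- Pairing `T_m f` with a finitely supported sequence. -/
theorem sum_conj_mul_multiplierOp {m : UnitAddTorus (Fin d) → ℂ} {f : ellp d 2}
    (hf : Integrable (multiplierSymbol m f) (torusMeasure d)) (S : Finset (Fin d → ℤ))
    (h : (Fin d → ℤ) → ℂ) :
    ∑ n ∈ S, starRingEnd ℂ (h n) * multiplierOp m f n =
      ∫ ξ, starRingEnd ℂ (fourierZ (restrictTo S h) ξ) * multiplierSymbol m f ξ
        ∂torusMeasure d := by
  simp only [multiplierOp_eq_integral]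
  simp_rw [← integral_const_mul]
  rw [← integral_finsetSum S fun n _ => (integrable_mFourier_mul hf (-n)).const_mul _]
  refine integral_congr_ae ?_
  filter_upwards [fourierZ_restrictTo S h] with ξ hξ
  rw [hξ, map_sum, Finset.sum_mul]
  refine Finset.sum_congr rfl fun n _ => ?_
  rw [map_mul, UnitAddTorus.mFourier_neg, mul_assoc]

theorem tsum_restrictTo (S : Finset (Fin d → ℤ)) (h : (Fin d → ℤ) → ℂ) {r : ℝ} (hr : 0 < r) :
    ∑' n, ENNReal.ofReal (‖restrictTo S h n‖ ^ r) = ENNReal.ofReal (∑ n ∈ S, ‖h n‖ ^ r) := by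
  rw [tsum_eq_sum (s := S), ENNReal.ofReal_sum_of_nonneg fun n _ => by positivity]
  · exact Finset.sum_congr rfl fun n hn => by rw [restrictTo_apply, if_pos hn]
  · intro n hn
    rw [restrictTo_apply, if_neg hn, norm_zero, Real.zero_rpow hr.ne', ENNReal.ofReal_zero]

/-! ### Duality and the bound on the unit ball -/

/-- The `ℓ^q` bound for a finite family of complex numbers follows by duality. -/
theorem sum_norm_rpow_le_of_dual {ι : Type*} (S : Finset ι) (a : ι → ℂ) {q r K : ℝ}
    (hqr : q.HolderConjugate r)
    (h : ∀ b : ι → ℂ, ∑ n ∈ S, ‖b n‖ ^ r ≤ 1 → ‖∑ n ∈ S, starRingEnd ℂ (b n) * a n‖ ≤ K) :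
    ∑ n ∈ S, ‖a n‖ ^ q ≤ K ^ q := by
  obtain ⟨g, hg, hga⟩ := (NNReal.isGreatest_Lp S (fun n => ‖a n‖₊) hqr).1
  simp only [Set.mem_ofPred_eq] at hg
  have hsign : ∀ z : ℂ, ‖z / (‖z‖ : ℂ)‖ ≤ 1 := fun z => by
    rw [norm_div, Complex.norm_real, norm_norm]; exact div_self_le_one _
  -- The extremiser for the moduli, multiplied by the phases of `a`.
  have hb := h (fun n => (g n : ℝ) * (a n / (‖a n‖ : ℂ))) ?_
  · have e : ∑ n ∈ S, starRingEnd ℂ ((g n : ℝ) * (a n / (‖a n‖ : ℂ))) * a n =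
        ((∑ n ∈ S, ‖a n‖₊ * g n : NNReal) : ℝ) := by
      push_cast
      refine Finset.sum_congr rfl fun n _ => ?_
      by_cases hn : a n = 0
      · simp [hn]
      have hn' : (‖a n‖ : ℂ) ≠ 0 := by simpa using hn
      simp only [map_mul, map_div₀, Complex.conj_ofReal]
      rw [mul_assoc, div_mul_eq_mul_div, Complex.conj_mul', sq, mul_div_assoc, div_self hn']
      ring
    simp only at hga
    rw [e, hga, Complex.norm_real, Real.norm_of_nonneg (NNReal.coe_nonneg _)] at hb
    have hsum : ((∑ n ∈ S, ‖a n‖₊ ^ q : NNReal) : ℝ) = ∑ n ∈ S, ‖a n‖ ^ q := by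
      push_cast; rfl
    rw [NNReal.coe_rpow, hsum] at hb
    have h0 : 0 ≤ ∑ n ∈ S, ‖a n‖ ^ q := Finset.sum_nonneg fun n _ => by positivity
    have := Real.rpow_le_rpow (by positivity) hb hqr.nonneg
    rwa [← Real.rpow_mul h0, one_div_mul_cancel hqr.ne_zero, Real.rpow_one] at this
  · have hg' : ∑ n ∈ S, (g n : ℝ) ^ r ≤ 1 := by exact_mod_cast hg
    refine le_trans (Finset.sum_le_sum fun n _ => ?_) hg'
    refine Real.rpow_le_rpow (norm_nonneg _) ?_ hqr.symm.nonneg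
    rw [norm_mul, Complex.norm_real, Real.norm_of_nonneg (NNReal.coe_nonneg _)]
    exact mul_le_of_le_one_right (NNReal.coe_nonneg _) (hsign _)

theorem exists_integrable_and_sum_multiplierOp_le {m : UnitAddTorus (Fin d) → ℂ} {α p q : ℝ}
    (hα : 0 < α) (hm : MemWeakLp m α) (hp : 1 < p) (hp2 : p ≤ 2) (hq : 2 ≤ q)
    (hpq : 1 / p - 1 / q = 1 / α) :
    ∃ K : ℝ, 0 ≤ K ∧ ∀ f : ellp d 2, ∑' n, ENNReal.ofReal (‖f n‖ ^ p) ≤ 1 →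
      Integrable (multiplierSymbol m f) (torusMeasure d) ∧
      ∀ S : Finset (Fin d → ℤ), ∑ n ∈ S, ‖multiplierOp m f n‖ ^ q ≤ K ^ q := by
  have hqr : q.HolderConjugate (Real.conjExponent q) := .conjExponent (by linarith)
  set r := Real.conjExponent q
  have hr : 1 < r := hqr.symm.lt
  have hrinv : 1 / r = 1 - 1 / q := by
    have := hqr.inv_add_inv_eq_one
    simp only [one_div]; linarith
  have hr2 : r ≤ 2 := by
    have h1 : 1 / q ≤ 1 / 2 := one_div_le_one_div_of_le (by norm_num) hq
    exact le_of_one_div_le_one_div (by linarith) (by linarith)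
  have hpr : α * (2 / p - 1) + α * (2 / r - 1) = 2 := by
    have e1 : 2 / p = 2 * (1 / p) := by ring
    have e2 : 2 / r = 2 * (1 / r) := by ring
    have e3 : α * (1 / α) = 1 := mul_one_div_cancel hα.ne'
    rw [e1, e2, hrinv]
    linear_combination 2 * α * hpq + 2 * e3
  obtain ⟨K, hK, hb⟩ :=
    exists_lintegral_enorm_mul_fourierZ_mul_fourierZ_le hα hm hp hp2 hr hr2 hpr
  refine ⟨K, hK, fun f hf => ?_⟩
  have hint : Integrable (multiplierSymbol m f) (torusMeasure d) := by
    refine ⟨aestronglyMeasurable_multiplierSymbol hm.1 f, ?_⟩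
    -- Testing against the unit mass at 0, whose transform has modulus 1, gives integrability of `m
    -- 𝓕f` itself.
    have h1 := hb f (restrictTo {0} fun _ => 1) hf (by
      rw [tsum_restrictTo _ _ (by linarith)]; simp)
    refine lt_of_le_of_lt (le_trans (le_of_eq ?_) h1) ENNReal.ofReal_lt_top
    refine lintegral_congr_ae ?_
    filter_upwards [fourierZ_restrictTo {(0 : Fin d → ℤ)} fun _ => 1] with ξ hξ
    rw [hξ]
    simp [multiplierSymbol, enorm_mul, enorm_mFourier_apply]
  refine ⟨hint, fun S => sum_norm_rpow_le_of_dual S _ hqr fun b hbS => ?_⟩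
  rw [sum_conj_mul_multiplierOp hint]
  have h1 := hb f (restrictTo S b) hf (by
    rw [tsum_restrictTo _ _ (by linarith)]; simpa using hbS)
  rw [← ENNReal.ofReal_le_ofReal_iff hK, ofReal_norm]
  refine (enorm_integral_le_lintegral_enorm _).trans (le_trans (le_of_eq ?_) h1)
  refine lintegral_congr fun ξ => ?_
  rw [enorm_mul, multiplierSymbol, enorm_mul, RCLike.enorm_conj]
  ring

/-! ### Assembling the bounded operator -/

/-- The inclusion of `ℓ^p` into `ℓ²` for `p ≤ 2`. -/
noncomputable def toEllTwo {p : ℝ≥0∞} (hp : p ≤ 2) : ellp d p →ₗ[ℂ] ellp d 2 where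
  toFun f := ⟨f, (lp.memℓp f).of_exponent_ge hp⟩
  map_add' _ _ := rfl
  map_smul' _ _ := rfl

/-- Boundedness `ℓ^p → ℓ^q` of the Fourier multiplier with symbol in weak `L^α`. -/
theorem MemWeakLp.isBoundedMultiplier {α p q : ℝ} {m : UnitAddTorus (Fin d) → ℂ}
    (hα : 1 < α) (hm : MemWeakLp m α) (hp : 1 < p) (hp2 : p ≤ 2) (hq : 2 ≤ q)
    (hpq : 1 / p - 1 / q ≥ 1 / α) :
    IsBoundedMultiplier m (ENNReal.ofReal p) (ENNReal.ofReal q) := by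
  have hp0 : 0 < p := by linarith
  have hq0 : 0 < q := by linarith
  have hδ : 0 < 1 / p - 1 / q := lt_of_lt_of_le (by positivity) hpq
  -- Lowering the weak exponent turns the hypothesis on `p`, `q` into an equality.
  have hm' : MemWeakLp m (1 / (1 / p - 1 / q)) :=
    hm.mono_exponent (by positivity) (by rw [one_div_le hδ (by linarith)]; exact hpq)
  obtain ⟨K, hK, h⟩ := exists_integrable_and_sum_multiplierOp_le (one_div_pos.2 hδ) hm' hp hp2 hq
    (one_div_one_div _).symm
  have hP : (ENNReal.ofReal p).toReal = p := ENNReal.toReal_ofReal hp0.le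
  have hQ : (ENNReal.ofReal q).toReal = q := ENNReal.toReal_ofReal hq0.le
  have hp2' : ENNReal.ofReal p ≤ 2 := by simpa using ENNReal.ofReal_le_ofReal hp2
  let J : ellp d (ENNReal.ofReal p) →ₗ[ℂ] ellp d 2 := toEllTwo hp2'
  -- Rescaling to the unit ball. `N = ‖f‖ + 1` gives integrability and membership for every `f`,
  -- zero included; `N = ‖f‖` gives the norm bound.
  have key : ∀ (f : ellp d (ENNReal.ofReal p)) (N : ℝ), 0 < N → ‖f‖ ≤ N →
      Integrable (multiplierSymbol m (J f)) (torusMeasure d) ∧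
      ∀ S : Finset (Fin d → ℤ), ∑ n ∈ S, ‖multiplierOp m (J f) n‖ ^ q ≤ (K * N) ^ q := by
    intro f N hN hfN
    set c : ℂ := ((N⁻¹ : ℝ) : ℂ)
    have hc : ‖c‖ = N⁻¹ := by
      rw [Complex.norm_real, Real.norm_of_nonneg (by positivity)]
    have hc0 : c ≠ 0 := norm_ne_zero_iff.1 (by rw [hc]; positivity)
    have hu : ∑' n, ENNReal.ofReal (‖(c • J f) n‖ ^ p) ≤ 1 := by
      rw [ENNReal.tsum_eq_iSup_sum]
      refine iSup_le fun S => ?_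
      rw [← ENNReal.ofReal_sum_of_nonneg fun n _ => by positivity, ENNReal.ofReal_le_one]
      have h1 := lp.sum_rpow_le_norm_rpow (by rw [hP]; exact hp0) f S
      rw [hP] at h1
      calc ∑ n ∈ S, ‖(c • J f) n‖ ^ p = N⁻¹ ^ p * ∑ n ∈ S, ‖f n‖ ^ p := by
            rw [Finset.mul_sum]
            refine Finset.sum_congr rfl fun n _ => ?_
            rw [lp.coeFn_smul, Pi.smul_apply, norm_smul, hc,
              Real.mul_rpow (by positivity) (norm_nonneg _)]
            rfl
        _ ≤ N⁻¹ ^ p * N ^ p := by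
            gcongr
            exact h1.trans (Real.rpow_le_rpow (lp.norm_nonneg' f) hfN hp0.le)
        _ = 1 := by
            rw [← Real.mul_rpow (by positivity) hN.le, inv_mul_cancel₀ hN.ne', Real.one_rpow]
    obtain ⟨h1, h2⟩ := h _ hu
    refine ⟨?_, fun S => ?_⟩
    · have h3 : Integrable (c • multiplierSymbol m (J f)) (torusMeasure d) :=
        h1.congr (multiplierSymbol_smul m c (J f))
      exact (integrable_smul_iff hc0 _).1 h3
    · have h3 := h2 S
      rw [multiplierOp_smul] at h3
      have h4 : ∀ n, ‖multiplierOp m (J f) n‖ ^ q =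
          N ^ q * ‖(c • multiplierOp m (J f)) n‖ ^ q := by
        intro n
        rw [Pi.smul_apply, norm_smul, hc, ← Real.mul_rpow hN.le (by positivity),
          mul_inv_cancel_left₀ hN.ne']
      simp_rw [h4]
      rw [← Finset.mul_sum, mul_comm K N, Real.mul_rpow hN.le hK]
      gcongr
  have hint : ∀ f, Integrable (multiplierSymbol m (J f)) (torusMeasure d) := fun f =>
    (key f (‖f‖ + 1) (by linarith [lp.norm_nonneg' f]) (by linarith)).1
  have hmem : ∀ f, Memℓp (multiplierOp m (J f)) (ENNReal.ofReal q) := fun f =>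
    memℓp_gen' (C := (K * (‖f‖ + 1)) ^ q) (by
      rw [hQ]
      exact (key f (‖f‖ + 1) (by linarith [lp.norm_nonneg' f]) (by linarith)).2)
  let T : ellp d (ENNReal.ofReal p) →ₗ[ℂ] ellp d (ENNReal.ofReal q) :=
    { toFun := fun f => ⟨multiplierOp m (J f), hmem f⟩
      map_add' := fun f g => lp.ext (by
        change multiplierOp m (J (f + g)) = multiplierOp m (J f) + multiplierOp m (J g)
        rw [map_add, multiplierOp_add (hint f) (hint g)])
      map_smul' := fun c f => lp.ext (by
        change multiplierOp m (J (c • f)) = c • multiplierOp m (J f)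
        rw [map_smul, multiplierOp_smul]) }
  refine ⟨T, ⟨K, fun f => ?_⟩, fun f => ⟨(J f).2, hint f, fun n => rfl⟩⟩
  rcases eq_or_ne f 0 with rfl | hf
  · rw [map_zero, lp.norm_zero, lp.norm_zero, mul_zero]
  have hf0 : 0 < ‖f‖ := (lp.norm_nonneg' f).lt_of_ne fun h0 => hf (lp.norm_eq_zero_iff.1 h0.symm)
  refine lp.norm_le_of_forall_sum_le (by rw [hQ]; exact hq0) (by positivity) fun S => ?_
  rw [hQ]
  exact (key f ‖f‖ hf0 le_rfl).2 S

end DiscreteMultiplier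

theorem mainTheorem11 (d : ℕ) (α p q : ℝ) (m : UnitAddTorus (Fin d) → ℂ)
    (hα : 1 < α) (hm : DiscreteMultiplier.MemWeakLp m α)
    (hp : 1 < p) (hp2 : p ≤ 2) (hq : 2 ≤ q) (hpq : 1 / p - 1 / q ≥ 1 / α) :
    DiscreteMultiplier.IsBoundedMultiplier m (ENNReal.ofReal p) (ENNReal.ofReal q) :=
  hm.isBoundedMultiplier hα hp hp2 hq hpq
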